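/- Let $n\ge 1$. Call $P\in\mathbb{Q}[x_1,\dots,x_n]$ quasi-symmetric if the coefficients of $x_1^{\nu_1}\cdots x_n^{\nu_n}$ and $x_1^{\mu_1}\cdots x_n^{\mu_n}$ in $P$ are equal whenever the sequences obtained from $\nu,\mu\in\mathbb{N}^n$ by erasing the zero entries coincide. Let $\mathcal{J}_n$ be the ideal of $\mathbb{Q}[x_1,\dots,x_n]$ generated by the quasi-symmetric polynomials with no constant term, let $\mathbf{R}_n=\mathbb{Q}[x_1,\dots,x_n]/\mathcal{J}_n$, and let $$\mathbf{SH}_n=\mathcal{J}_n^{\perp}=\{Q\in\mathbb{Q}[x_1,\dots,x_n] : \langle P,Q\rangle=0\ \text{for all } P\in\mathcal{J}_n\},$$ where $\langle P,Q\rangle=P(\partial_{x_1},\dots,\partial_{x_n})\,Q\,\big|_{x_1=\cdots=x_n=0}$. For $k\ge 0$ let $\mathbf{SH}_n^{(k)}$ be the space of elements of $\mathbf{SH}_n$ that are homogeneous of degree $k$ (together with $0$), and let $\mathbf{R}_n^{(k)}$ be the image in $\mathbf{R}_n$ of the homogeneous polynomials of degree $k$ (together with $0$). A Dyck path of length $2n$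 is a path from $(0,0)$ to $(2n,0)$ with $n$ rising steps $(1,1)$ and $n$ falling steps $(1,-1)$ that never goes below the horizontal axis. Let $D_n^{(j)}$ be the number of Dyck paths of length $2n$ that end with exactly $j$ falling steps, and let $C_n^{(j)}$ be the number of those that have exactly $j$ factors, i.e. exactly $j+1$ points on the horizontal axis. Then $\mathbf{SH}_n$ and $\mathbf{R}_n$ are finite-dimensional over $\mathbb{Q}$, and $$\dim\mathbf{SH}_n=\dim\mathbf{R}_n=C_n=\frac{1}{n+1}\binom{2n}{n},$$ the $n$-th Catalan number. Moreover, for $0\le k\le n-1$, $$\dim\mathbf{SH}_n^{(k)}=\dim\mathbf{R}_n^{(k)}=D_n^{(n-k)}=C_n^{(n-k)}=\frac{n-k}{n+k}\binom{n+k}{k},$$ while $\dim\mathbf{SH}_n^{(k)}=\dim\mathbf{R}_n^{(k)}=0$ for $k\ge n$. In other words, the Hilbert series of $\mathbf{SH}_n$ is $$\sum_{k\ge 0}\dim\mathbf{SH}_n^{(k)}\,t^k=\sum_{k=0}^{n-1}\frac{n-k}{n+k}\binom{n+k}{k}t^k.$$ -/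

import Mathlib

namespace SuperCovariant

/-- The composition `c(ν)` obtained by erasing the zeros of the vector `ν ∈ ℕⁿ`. -/
def compositionOf {n : ℕ} (ν : Fin n →₀ ℕ) : List ℕ :=
  (List.ofFn ν).filter (· ≠ 0)

/-- `P ∈ ℚ[x₁, …, xₙ]` is quasi-symmetric if the coefficients of `X^ν` and `X^μ` in `P` agree
whenever `c(ν) = c(μ)`. -/
def IsQuasiSymmetric {n : ℕ} (P : MvPolynomial (Fin n) ℚ) : Prop :=
  ∀ ν μ : Fin n →₀ ℕ, compositionOf ν = compositionOf μ → P.coeff ν = P.coeff μ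

/-- The ideal `J_n` generated by the quasi-symmetric polynomials with no constant term. -/
noncomputable def J (n : ℕ) : Ideal (MvPolynomial (Fin n) ℚ) :=
  Ideal.span {P | IsQuasiSymmetric P ∧ MvPolynomial.constantCoeff P = 0}

/-- The quotient ring `R_n = ℚ[x₁, …, xₙ] / J_n`. -/
abbrev R (n : ℕ) : Type := MvPolynomial (Fin n) ℚ ⧸ J n

/-- The degree `k` component of `R_n`: the classes of the homogeneous polynomials of degree `k`. -/
noncomputable def RDeg (n k : ℕ) : Submodule ℚ (R n) :=
  (MvPolynomial.homogeneousSubmodule (Fin n) ℚ k).map (Ideal.Quotient.mkₐ ℚ (J n)).toLinearMap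

/-- The operator `∂^ν = ∂₁^{ν₁} ⋯ ∂ₙ^{νₙ}` on `ℚ[x₁, …, xₙ]`. -/
noncomputable def monomialDiff {n : ℕ} (ν : Fin n →₀ ℕ) :
    Module.End ℚ (MvPolynomial (Fin n) ℚ) :=
  (List.ofFn fun i : Fin n =>
    ((MvPolynomial.pderiv i).toLinearMap : Module.End ℚ (MvPolynomial (Fin n) ℚ)) ^ ν i).prod

/-- The differential operator `P(∂)`, obtained by substituting `∂ᵢ` for `xᵢ` in `P`. -/
noncomputable def diffOp {n : ℕ} (P : MvPolynomial (Fin n) ℚ) :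
    Module.End ℚ (MvPolynomial (Fin n) ℚ) :=
  ∑ ν ∈ P.support, P.coeff ν • monomialDiff ν

/-- The pairing `⟨P, Q⟩ = P(∂) Q |_{X = 0}`. -/
noncomputable def pairing {n : ℕ} (P Q : MvPolynomial (Fin n) ℚ) : ℚ :=
  MvPolynomial.eval (0 : Fin n → ℚ) (diffOp P Q)

/-- The space `SH_n = J_n^⊥` of super-covariant polynomials. -/
noncomputable def SH (n : ℕ) : Submodule ℚ (MvPolynomial (Fin n) ℚ) where
  carrier := {Q | ∀ P ∈ J n, pairing P Q = 0}
  zero_mem' := by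
    intro P _
    simp [pairing]
  add_mem' := by
    intro Q Q' hQ hQ' P hP
    have h := hQ P hP
    have h' := hQ' P hP
    simp only [pairing] at h h' ⊢
    rw [map_add, map_add, h, h', add_zero]
  smul_mem' := by
    intro a Q hQ P hP
    have h := hQ P hP
    simp only [pairing] at h ⊢
    rw [map_smul, MvPolynomial.smul_eval, h, mul_zero]

/-- The space `SH_n^{(k)}` of super-covariant polynomials that are homogeneous of degree `k`
(together with zero). -/
noncomputable def SHDeg (n k : ℕ) : Submodule ℚ (MvPolynomial (Fin n) ℚ) :=
  SH n ⊓ MvPolynomial.homogeneousSubmodule (Fin n) ℚ k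

/-- The Hilbert series of `SH_n`, as a formal power series. -/
noncomputable def hilbertSeries (n : ℕ) : PowerSeries ℚ :=
  PowerSeries.mk fun k => (Module.finrank ℚ (SHDeg n k) : ℚ)

/-- The number of points of a Dyck path that lie on the horizontal axis, endpoints included. -/
def axisPoints (p : DyckWord) : ℕ :=
  ((Finset.range (p.toList.length + 1)).filter fun i =>
    (p.toList.take i).count DyckStep.U = (p.toList.take i).count DyckStep.D).card

/-- The number of falling steps at the end of a Dyck path. -/
def finalFalls (p : DyckWord) : ℕ :=
  (p.toList.reverse.takeWhile (· = DyckStep.D)).length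

/-- The number of Dyck paths of length `2n` that end by exactly `k` falling steps. -/
noncomputable def dyckByFinalFalls (n k : ℕ) : ℕ :=
  {p : DyckWord | p.semilength = n ∧ finalFalls p = k}.ncard

/-- The number of Dyck paths of length `2n` that have exactly `k` factors, that is, exactly
`k + 1` points on the horizontal axis. -/
noncomputable def dyckByFactors (n k : ℕ) : ℕ :=
  {p : DyckWord | p.semilength = n ∧ axisPoints p = k + 1}.ncard

end SuperCovariant

/-! Everything rests on one monomial basis of `R n`: the classes of the monomials whose exponent `ν`
satisfies `ν₁ + ⋯ + νⱼ < j` for all `j`.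

Spanning (`eq_zero_of_excessIdeal_of_isBallot`): `J n` contains the fundamental quasi-symmetric
polynomial of every composition that violates these inequalities somewhere. Splitting off the first
variable turns such a polynomial into its leading power of `x₁` times a fundamental polynomial in
fewer variables, plus terms with lower powers of `x₁`. A slack parameter `m` records how much of the
bound the first exponents have left, so the induction on `n` closes.

Independence (`eq_zero_of_mem_J_of_isBallot`): setting one of two neighbouring variables to zero,
subtracting and dividing by a variable sends `J (n + 1)` to `J n` and ballot support to ballot
support. By induction these divided differences of a ballot-supported element of the ideal vanish.
Its coefficients are therefore unchanged when a nonzero exponent moves left past a zero, and the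
first exponent of a ballot monomial is zero; only the constant term is left, and it vanishes in `J
n`.

The pairing is diagonal on monomials with nonzero entries, so `SH n` is dual to `R n`, degree by
degree (`nonempty_linearEquiv_ballotSet`). Ballot exponents by degree and the coefficients of `(X *
C(X)) ^ j`, with `C` the Catalan series, both obey the recurrence of Catalan's triangle. The two
Dyck path statistics satisfy convolution recurrences of the same coefficients, by first-return
decomposition. -/

namespace SuperCovariant

section

open MvPolynomial

/-! ### Ballot exponents and fundamental quasi-symmetric polynomials -/

/-- The sum of the entries of `ν` at positions below `j`. -/
def partialSum {n : ℕ} (ν : Fin n →₀ ℕ) (j : ℕ) : ℕ :=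
  ∑ i : Fin n, if (i : ℕ) < j then ν i else 0

/-- The exponents `ν` with `ν₁ + ⋯ + νⱼ ≤ j - 1 + m` for `1 ≤ j ≤ n`. For `m = 0` they encode
Dyck paths. -/
def IsBallot {n : ℕ} (m : ℕ) (ν : Fin n →₀ ℕ) : Prop :=
  ∀ j < n, partialSum ν (j + 1) ≤ j + m

theorem partialSum_cons {n : ℕ} (a : ℕ) (ν : Fin n →₀ ℕ) (j : ℕ) :
    partialSum (Finsupp.cons a ν) (j + 1) = a + partialSum ν j := by
  simp [partialSum, Fin.sum_univ_succ]

theorem isBallot_cons {n a m : ℕ} {ν : Fin n →₀ ℕ} (ha : a ≤ m) (h : IsBallot (m + 1 - a) ν) :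
    IsBallot m (Finsupp.cons a ν) := by
  intro j hj
  rw [partialSum_cons]
  rcases j with _ | j
  · simp [partialSum, ha]
  · have := h j (by omega)
    omega

/-- The fundamental quasi-symmetric polynomial of a composition, by recursion on the number of
variables. -/
noncomputable def fundamental : (n : ℕ) → List ℕ → MvPolynomial (Fin n) ℚ
  | _, [] => 1
  | 0, _ :: _ => 0
  | n + 1, c :: γ => X 0 ^ c * rename Fin.succ (fundamental n γ) +
      ∑ i ∈ Finset.range c, X 0 ^ i * rename Fin.succ (fundamental n ((c - i) :: γ))

theorem fundamental_nil (n : ℕ) : fundamental n [] = 1 := by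
  cases n <;> rfl

theorem fundamental_cons (n c : ℕ) (γ : List ℕ) :
    fundamental (n + 1) (c :: γ) = X 0 ^ c * rename Fin.succ (fundamental n γ) +
      ∑ i ∈ Finset.range c, X 0 ^ i * rename Fin.succ (fundamental n ((c - i) :: γ)) := rfl

theorem fundamental_one_cons (n : ℕ) (γ : List ℕ) :
    fundamental (n + 1) (1 :: γ) = X 0 * rename Fin.succ (fundamental n γ) +
      rename Fin.succ (fundamental n (1 :: γ)) := by
  simp [fundamental_cons]

theorem fundamental_succ_cons (n c : ℕ) (γ : List ℕ) :
    fundamental (n + 1) ((c + 1) :: γ) = X 0 * fundamental (n + 1) (c :: γ) +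
      rename Fin.succ (fundamental n ((c + 1) :: γ)) := by
  simp only [fundamental_cons, Finset.sum_range_succ', mul_add, Finset.mul_sum]
  simp only [Nat.add_sub_add_right, pow_succ', pow_zero, one_mul, Nat.sub_zero, mul_assoc]
  ring

/-- Whether a composition `β` refines the composition `α`, as a number. -/
def refines : List ℕ → List ℕ → ℚ
  | [], [] => 1
  | [], _ :: _ => 0
  | _ :: _, [] => 0
  | b :: β, c :: γ => if b < c then refines β ((c - b) :: γ) else if b = c then refines β γ else 0

theorem compositionOf_cons {n : ℕ} (a : ℕ) (ν : Fin n →₀ ℕ) :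
    compositionOf (Finsupp.cons a ν) =
      if a = 0 then compositionOf ν else a :: compositionOf ν := by
  simp only [compositionOf, List.ofFn_succ, Finsupp.cons_zero, Finsupp.cons_succ]
  by_cases h : a = 0 <;> simp [h]

theorem cons_eq_single_add {n : ℕ} (a : ℕ) (ν : Fin n →₀ ℕ) :
    Finsupp.cons a ν = Finsupp.single 0 a + ν.mapDomain Fin.succ := by
  ext i
  refine Fin.cases ?_ (fun i => ?_) i
  · rw [Finsupp.add_apply, Finsupp.mapDomain_of_notMem_range]
    · simp
    · simp
  · rw [Finsupp.add_apply, Finsupp.mapDomain_apply (Fin.succ_injective n)]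
    simp [Fin.succ_ne_zero]

theorem coeff_cons_X_pow_mul_rename {n : ℕ} (a b : ℕ) (ν : Fin n →₀ ℕ)
    (P : MvPolynomial (Fin n) ℚ) :
    coeff (Finsupp.cons a ν) (X 0 ^ b * rename Fin.succ P) = if a = b then coeff ν P else 0 := by
  rw [X_pow_eq_monomial, coeff_monomial_mul']
  by_cases hba : b ≤ a
  · have h1 : Finsupp.single 0 b ≤ Finsupp.cons a ν := by
      simpa [Finsupp.single_le_iff] using hba
    have h2 : Finsupp.cons a ν - Finsupp.single 0 b = Finsupp.cons (a - b) ν := by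
      ext i
      refine Fin.cases ?_ (fun i => ?_) i <;> simp [Fin.succ_ne_zero]
    rw [if_pos h1, one_mul, h2]
    split_ifs with hab
    · subst hab
      rw [Nat.sub_self, cons_eq_single_add, Finsupp.single_zero, zero_add,
        coeff_rename_mapDomain _ (Fin.succ_injective n)]
    · apply coeff_rename_eq_zero
      intro u hu
      exfalso
      have := DFunLike.congr_fun hu 0
      rw [Finsupp.mapDomain_of_notMem_range _ _ (by simp)] at this
      simp only [Finsupp.cons_zero] at this
      omega
  · rw [if_neg, if_neg (by omega)]
    simpa [Finsupp.single_le_iff] using hba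

/-- The recursion of `fundamental` on the exponent of the first variable matches that of `refines`
on the first part. Since the right side sees `ν` only through its composition, quasi-symmetry
follows. -/
theorem coeff_fundamental {n : ℕ} (α : List ℕ) (hα : ∀ a ∈ α, 0 < a) (ν : Fin n →₀ ℕ) :
    coeff ν (fundamental n α) = refines (compositionOf ν) α := by
  induction n generalizing α with
  | zero =>
    have : ν = 0 := Subsingleton.elim _ _
    subst this
    cases α <;> simp [fundamental, compositionOf, refines]
  | succ n ih =>
    rw [← Finsupp.cons_tail ν]
    set a := ν 0
    set μ := ν.tail
    rw [compositionOf_cons]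
    cases α with
    | nil =>
      have h1 : (fundamental (n + 1) [] : MvPolynomial (Fin (n + 1)) ℚ) =
          X 0 ^ 0 * rename Fin.succ (fundamental n []) := by simp [fundamental_nil]
      rw [h1, coeff_cons_X_pow_mul_rename, ih _ (by simp)]
      split_ifs <;> simp [refines]
    | cons c γ =>
      have hc : 0 < c := hα c (by simp)
      have hγ : ∀ a ∈ γ, 0 < a := fun a ha => hα a (by simp [ha])
      rw [fundamental_cons, coeff_add, coeff_sum]
      simp only [coeff_cons_X_pow_mul_rename, Finset.sum_ite_eq, Finset.mem_range]
      rw [ih γ hγ]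
      by_cases h0 : a = 0
      · rw [if_neg (by omega), if_pos (by omega), if_pos h0, ih _ (by simpa [h0] using hα)]
        simp [h0]
      · rw [if_neg h0, refines]
        by_cases h1 : a < c
        · rw [if_neg (by omega), if_pos h1, if_pos h1, ih, zero_add]
          simpa [h1] using hγ
        · simp [h1]

theorem isQuasiSymmetric_fundamental (n : ℕ) (α : List ℕ) (hα : ∀ a ∈ α, 0 < a) :
    IsQuasiSymmetric (fundamental n α) := by
  intro ν μ h
  rw [coeff_fundamental α hα, coeff_fundamental α hα, h]

theorem compositionOf_zero (n : ℕ) : compositionOf (0 : Fin n →₀ ℕ) = [] := by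
  simp [compositionOf]

theorem constantCoeff_fundamental (n c : ℕ) (γ : List ℕ) (h : ∀ a ∈ c :: γ, 0 < a) :
    constantCoeff (fundamental n (c :: γ)) = 0 := by
  rw [constantCoeff_eq, coeff_fundamental _ h, compositionOf_zero, refines]

/-! ### Spanning by ballot monomials -/

/-- Some nonempty prefix of the list has a sum exceeding its length by at least `m`. -/
def Exceeds : ℕ → List ℕ → Prop
  | _, [] => False
  | m, c :: γ => m + 1 ≤ c ∨ Exceeds (m + 1 - c) γ

theorem Exceeds.mono {m m' : ℕ} {α : List ℕ} (h : Exceeds m α) (hm : m' ≤ m) : Exceeds m' α := by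
  induction α generalizing m m' with
  | nil => exact h
  | cons c γ ih =>
    rcases h with h | h
    · exact Or.inl (by omega)
    · exact Or.inr (ih h (by omega))

/-- The ideal generated by the fundamental quasi-symmetric polynomials of the compositions
exceeding `m`. -/
noncomputable def excessIdeal (n m : ℕ) : Ideal (MvPolynomial (Fin n) ℚ) :=
  Ideal.span {P | ∃ α : List ℕ, (∀ a ∈ α, 0 < a) ∧ Exceeds m α ∧ fundamental n α = P}

theorem fundamental_mem_excessIdeal {n m : ℕ} {α : List ℕ} (hα : ∀ a ∈ α, 0 < a)
    (h : Exceeds m α) : fundamental n α ∈ excessIdeal n m :=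
  Ideal.subset_span ⟨α, hα, h, rfl⟩

theorem excessIdeal_le_J (n m : ℕ) : excessIdeal n m ≤ J n := by
  rw [excessIdeal, Ideal.span_le]
  rintro _ ⟨α, hα, h, rfl⟩
  cases α with
  | nil => exact h.elim
  | cons c γ =>
    exact Ideal.subset_span
      ⟨isQuasiSymmetric_fundamental n _ hα, constantCoeff_fundamental n c γ hα⟩

/-- By the one-step recursion, `F_α(x₂, …) = F_α - x₁ * G`, where `G` comes from lowering the first
part of `α` by one. This costs one unit of excess, or none if the part is `1` and disappears; in
that case `G` is again free of `x₁`, hence the induction on `α`. -/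
theorem rename_fundamental_mem_excessIdeal {n m : ℕ} {α : List ℕ} (hα : ∀ a ∈ α, 0 < a)
    (h : Exceeds (m + 1) α) : rename Fin.succ (fundamental n α) ∈ excessIdeal (n + 1) m := by
  induction α with
  | nil => exact h.elim
  | cons c γ ih =>
    have hc : 0 < c := hα c (by simp)
    have hγ : ∀ a ∈ γ, 0 < a := fun a ha => hα a (by simp [ha])
    have h1 : fundamental (n + 1) (c :: γ) ∈ excessIdeal (n + 1) m :=
      fundamental_mem_excessIdeal hα (h.mono (by omega))
    obtain rfl | ⟨d, rfl⟩ : c = 1 ∨ ∃ d, c = d + 1 + 1 := by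
      by_cases hc1 : c = 1
      · exact Or.inl hc1
      · exact Or.inr ⟨c - 2, by omega⟩
    · rw [fundamental_one_cons] at h1
      refine (Ideal.add_mem_iff_right _ (Ideal.mul_mem_left _ _ (ih hγ ?_))).1 h1
      rcases h with h | h
      · omega
      · exact h
    · rw [fundamental_succ_cons] at h1
      refine (Ideal.add_mem_iff_right _ (Ideal.mul_mem_left _ _ ?_)).1 h1
      refine fundamental_mem_excessIdeal ?_ ?_
      · simpa using hγ
      · rcases h with h | h
        · exact Or.inl (by omega)
        · exact Or.inr (h.mono (by omega))

theorem monomial_cons {n : ℕ} (a : ℕ) (ν : Fin n →₀ ℕ) :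
    (monomial (Finsupp.cons a ν) 1 : MvPolynomial (Fin (n + 1)) ℚ) =
      X 0 ^ a * rename Fin.succ (monomial ν 1) := by
  rw [rename_monomial, X_pow_eq_monomial, monomial_mul, one_mul, cons_eq_single_add]

theorem linearMap_eq_zero_of_monomial {σ : Type*} {φ : MvPolynomial σ ℚ →ₗ[ℚ] ℚ}
    (h : ∀ η, φ (monomial η 1) = 0) : φ = 0 :=
  (basisMonomials σ ℚ).ext fun η => by simpa using h η

/-- A linear functional that kills `excessIdeal n m` and the ballot monomials is zero. -/
theorem eq_zero_of_excessIdeal_of_isBallot (n m : ℕ) (φ : MvPolynomial (Fin n) ℚ →ₗ[ℚ] ℚ)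
    (hI : ∀ P ∈ excessIdeal n m, φ P = 0)
    (hB : ∀ η : Fin n →₀ ℕ, IsBallot m η → φ (monomial η 1) = 0) : φ = 0 := by
  induction n generalizing m with
  | zero =>
    exact linearMap_eq_zero_of_monomial fun η => hB η (fun j hj => absurd hj (by omega))
  | succ n ih =>
    -- The outer induction removes a variable, the inner one runs over the power of the first
    -- variable.
    have key : ∀ (a : ℕ) (g : MvPolynomial (Fin n) ℚ), φ (X 0 ^ a * rename Fin.succ g) = 0 := by
      intro a
      induction a using Nat.strong_induction_on with
      | _ a iha =>
      let ψ : MvPolynomial (Fin n) ℚ →ₗ[ℚ] ℚ :=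
        φ ∘ₗ LinearMap.mulLeft ℚ (X 0 ^ a) ∘ₗ (rename Fin.succ).toLinearMap
      have hψ : ∀ g, ψ g = φ (X 0 ^ a * rename Fin.succ g) := fun g => rfl
      -- In `F_{a :: α}` the top term is `x₁ ^ a * F_α(x₂, …)`; the other terms carry lower powers
      -- of `x₁` and are killed by the inner induction.
      have hF : ∀ α : List ℕ, (∀ b ∈ α, 0 < b) → Exceeds m (a :: α) → 0 < a →
          ∀ g, ψ (g * fundamental n α) = 0 := by
        intro α hα hE ha g
        have h1 : φ (rename Fin.succ g * fundamental (n + 1) (a :: α)) = 0 :=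
          hI _ (Ideal.mul_mem_left _ _ (fundamental_mem_excessIdeal
            (by simpa [ha] using hα) hE))
        rw [fundamental_cons, mul_add, map_add, Finset.mul_sum, map_sum,
          Finset.sum_eq_zero, add_zero] at h1
        · rw [hψ, map_mul (rename Fin.succ), ← h1]
          refine congrArg φ ?_
          ring
        · intro i hi
          rw [mul_left_comm, ← map_mul]
          exact iha i (Finset.mem_range.1 hi) _
      suffices h : ψ = 0 by
        intro g
        rw [← hψ, h, LinearMap.zero_apply]
      -- If `a ≤ m`, an exponent with first entry `a` leaves slack `m + 1 - a` for the others. If `a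
      -- > m`, the one-part composition `[a]` already exceeds, so `ψ` vanishes outright.
      by_cases ham : a ≤ m
      · refine ih (m + 1 - a) ψ ?_ ?_
        · suffices h : ∀ P ∈ excessIdeal n (m + 1 - a), ∀ g, ψ (g * P) = 0 by
            intro P hP
            simpa using h P hP 1
          intro P hP
          induction hP using Submodule.span_induction with
          | mem P hP =>
            obtain ⟨α, hα, hE, rfl⟩ := hP
            intro g
            -- A zero entry is no part of a composition, so `hF` does not apply to `a = 0`; there
            -- the slack rises to `m + 1` instead.
            rcases Nat.eq_zero_or_pos a with ha | ha
            · rw [hψ, ha, pow_zero, one_mul, map_mul (rename Fin.succ)]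
              refine hI _ (Ideal.mul_mem_left _ _ (rename_fundamental_mem_excessIdeal hα ?_))
              simpa [ha] using hE
            · exact hF α hα (Or.inr hE) ha g
          | zero => simp
          | add P Q _ _ hP hQ => intro g; rw [mul_add, map_add, hP, hQ, add_zero]
          | smul c P _ hP => intro g; rw [smul_eq_mul, ← mul_assoc]; exact hP _
        · intro η hη
          rw [hψ, ← monomial_cons]
          exact hB _ (isBallot_cons ham hη)
      · refine linearMap_eq_zero_of_monomial fun η => ?_
        simpa [fundamental_nil] using
          hF [] (by simp) (Or.inl (by omega)) (by omega) (monomial η 1)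
    refine linearMap_eq_zero_of_monomial fun η => ?_
    rw [← Finsupp.cons_tail η, monomial_cons]
    exact key (η 0) (monomial η.tail 1)

/-! ### Independence through quasi-symmetric divided differences -/

/-- The Bergeron–Sottile map, which sets the variable at position `p` to zero and renumbers the
other ones. -/
noncomputable def eraseVar {n : ℕ} (p : Fin (n + 1)) :
    MvPolynomial (Fin (n + 1)) ℚ →ₐ[ℚ] MvPolynomial (Fin n) ℚ :=
  killCompl (Fin.succAbove_right_injective (p := p))

/-- The exponent obtained by inserting a zero at position `p`. -/
noncomputable def insertZero {n : ℕ} (p : Fin (n + 1)) (ν : Fin n →₀ ℕ) : Fin (n + 1) →₀ ℕ :=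
  ν.mapDomain p.succAbove

theorem coeff_eraseVar {n : ℕ} (p : Fin (n + 1)) (f : MvPolynomial (Fin (n + 1)) ℚ)
    (ν : Fin n →₀ ℕ) : coeff ν (eraseVar p f) = coeff (insertZero p ν) f :=
  coeff_killCompl _

@[simp] theorem insertZero_same {n : ℕ} (p : Fin (n + 1)) (ν : Fin n →₀ ℕ) :
    insertZero p ν p = 0 :=
  Finsupp.mapDomain_of_notMem_range _ _ (by simp)

@[simp] theorem insertZero_succAbove {n : ℕ} (p : Fin (n + 1)) (ν : Fin n →₀ ℕ) (i : Fin n) :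
    insertZero p ν (p.succAbove i) = ν i :=
  Finsupp.mapDomain_apply Fin.succAbove_right_injective _ _

theorem exists_eq_insertZero {n : ℕ} {p : Fin (n + 1)} {η : Fin (n + 1) →₀ ℕ} (h : η p = 0) :
    ∃ ν, η = insertZero p ν := by
  refine ⟨η.comapDomain p.succAbove Fin.succAbove_right_injective.injOn, ?_⟩
  ext i
  rcases Fin.eq_self_or_eq_succAbove p i with rfl | ⟨j, rfl⟩ <;> simp [h]

theorem filter_ofFn_removeNth {n : ℕ} (p : Fin (n + 1)) (η : Fin (n + 1) → ℕ) (h : η p = 0) :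
    (List.ofFn η).filter (· ≠ 0) = (List.ofFn fun i => η (p.succAbove i)).filter (· ≠ 0) := by
  induction n with
  | zero =>
    have hp : p = 0 := Fin.fin_one_eq_zero p
    subst hp
    simp [h]
  | succ n ih =>
    rw [List.ofFn_succ]
    refine Fin.cases (fun h => ?_) (fun q h => ?_) p h
    · simp [h]
    · rw [List.ofFn_succ (f := fun i => η (q.succ.succAbove i)), List.filter_cons,
        List.filter_cons, Fin.succ_succAbove_zero]
      simp only [Fin.succ_succAbove_succ]
      rw [ih q (fun i => η i.succ) h]

theorem compositionOf_insertZero {n : ℕ} (p : Fin (n + 1)) (ν : Fin n →₀ ℕ) :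
    compositionOf (insertZero p ν) = compositionOf ν := by
  rw [compositionOf, filter_ofFn_removeNth p _ (by simp)]
  simp [compositionOf]

theorem insertZero_castSucc_eq_succ {n : ℕ} {i : Fin n} {ν : Fin n →₀ ℕ} (h : ν i = 0) :
    insertZero i.castSucc ν = insertZero i.succ ν := by
  refine Finsupp.mapDomain_congr fun j hj => ?_
  have hji : j ≠ i := by
    rintro rfl
    simp [h] at hj
  have hval : (j : ℕ) ≠ i := fun h => hji (Fin.ext h)
  ext
  simp only [Fin.succAbove, Fin.lt_def, Fin.val_castSucc, Fin.val_succ]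
  split_ifs <;> simp <;> omega

theorem X_dvd_of_coeff {σ : Type*} (i : σ) (f : MvPolynomial σ ℚ)
    (h : ∀ ν : σ →₀ ℕ, ν i = 0 → coeff ν f = 0) : X i ∣ f := by
  rw [X_dvd_iff_modMonomial_eq_zero]
  ext ν
  by_cases hν : Finsupp.single i 1 ≤ ν
  · rw [coeff_modMonomial_of_le _ hν, coeff_zero]
  · rw [coeff_modMonomial_of_not_le _ hν, coeff_zero]
    refine h ν ?_
    rw [Finsupp.single_le_iff] at hν
    omega

/-- Where `ν i = 0`, a zero inserted just before or just after position `i` gives the same exponent,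
so the coefficients free of `X i` cancel. -/
theorem X_dvd_eraseVar_sub {n : ℕ} (i : Fin n) (f : MvPolynomial (Fin (n + 1)) ℚ) :
    X i ∣ eraseVar i.succ f - eraseVar i.castSucc f := by
  refine X_dvd_of_coeff i _ fun ν hν => ?_
  rw [coeff_sub, coeff_eraseVar, coeff_eraseVar, insertZero_castSucc_eq_succ hν, sub_self]

theorem IsQuasiSymmetric.eraseVar {n : ℕ} {f : MvPolynomial (Fin (n + 1)) ℚ}
    (hf : IsQuasiSymmetric f) (p : Fin (n + 1)) : IsQuasiSymmetric (eraseVar p f) := by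
  intro ν μ h
  rw [coeff_eraseVar, coeff_eraseVar]
  exact hf _ _ (by rw [compositionOf_insertZero, compositionOf_insertZero, h])

theorem IsQuasiSymmetric.eraseVar_eq {n : ℕ} {f : MvPolynomial (Fin (n + 1)) ℚ}
    (hf : IsQuasiSymmetric f) (p q : Fin (n + 1)) :
    SuperCovariant.eraseVar p f = SuperCovariant.eraseVar q f := by
  ext ν
  rw [coeff_eraseVar, coeff_eraseVar]
  exact hf _ _ (by rw [compositionOf_insertZero, compositionOf_insertZero])

theorem eraseVar_mem_J {n : ℕ} (p : Fin (n + 1)) {f : MvPolynomial (Fin (n + 1)) ℚ}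
    (hf : f ∈ J (n + 1)) : eraseVar p f ∈ J n := by
  suffices h : J (n + 1) ≤ (J n).comap (eraseVar p) from h hf
  rw [J, Ideal.span_le]
  rintro f ⟨hf, h0⟩
  refine Ideal.subset_span ⟨hf.eraseVar p, ?_⟩
  rw [constantCoeff_eq] at h0 ⊢
  rw [coeff_eraseVar, insertZero, Finsupp.mapDomain_zero, h0]

/-- The quasi-symmetric divided differences map `J (n + 1)` to `J n`. -/
theorem exists_dividedDifference {n : ℕ} (i : Fin n) {f : MvPolynomial (Fin (n + 1)) ℚ}
    (hf : f ∈ J (n + 1)) :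
    ∃ h ∈ J n, eraseVar i.succ f - eraseVar i.castSucc f = X i * h := by
  rw [J] at hf
  induction hf using Submodule.span_induction with
  | mem f hf => exact ⟨0, zero_mem _, by rw [hf.1.eraseVar_eq i.succ i.castSucc]; simp⟩
  | zero => exact ⟨0, zero_mem _, by simp⟩
  | add f g _ _ hf hg =>
    obtain ⟨h, hh, h1⟩ := hf
    obtain ⟨k, hk, h2⟩ := hg
    refine ⟨h + k, add_mem hh hk, ?_⟩
    rw [map_add, map_add, mul_add, ← h1, ← h2]
    ring
  -- A twisted Leibniz rule: the difference of a product is `R'(c) * (R'(f) - R(f)) + (R'(c) - R(c))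
  -- * R(f)`, and `R` maps the ideal into the ideal.
  | smul c f hf ih =>
    obtain ⟨h, hh, h1⟩ := ih
    obtain ⟨q, hq⟩ := X_dvd_eraseVar_sub i c
    refine ⟨eraseVar i.succ c * h + q * eraseVar i.castSucc f,
      add_mem (Ideal.mul_mem_left _ _ hh) (Ideal.mul_mem_left _ _ (eraseVar_mem_J _ hf)), ?_⟩
    rw [smul_eq_mul, map_mul, map_mul]
    linear_combination (eraseVar i.succ c) * h1 + eraseVar i.castSucc f * hq

theorem partialSum_insertZero {n : ℕ} (p : Fin (n + 1)) (ν : Fin n →₀ ℕ) (j : ℕ) :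
    partialSum (insertZero p ν) j =
      ∑ i : Fin n, if (p.succAbove i : ℕ) < j then ν i else 0 := by
  simp [partialSum, Fin.sum_univ_succAbove _ p]

theorem partialSum_add_single {n : ℕ} (ν : Fin n →₀ ℕ) (i : Fin n) (j : ℕ) :
    partialSum (ν + Finsupp.single i 1) j = partialSum ν j + if (i : ℕ) < j then 1 else 0 := by
  have h : ∀ l : Fin n, (if (l : ℕ) < j then (ν + Finsupp.single i 1 : Fin n →₀ ℕ) l else 0) =
      (if (l : ℕ) < j then ν l else 0) + if i = l then (if (i : ℕ) < j then 1 else 0) else 0 := by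
    intro l
    rw [Finsupp.add_apply, Finsupp.single_apply]
    by_cases hil : i = l
    · subst hil
      split_ifs <;> simp
    · simp [hil]
  rw [partialSum, partialSum, Finset.sum_congr rfl fun l _ => h l, Finset.sum_add_distrib,
    Finset.sum_ite_eq, if_pos (Finset.mem_univ i)]

/-- Prefixes ending before `i` are untouched by the insertion. A prefix reaching `i` may need one
more entry after the insertion, which loosens its bound by one, but dropping the unit at `i`
compensates. -/
theorem IsBallot.of_insertZero {n : ℕ} {i : Fin n} {p : Fin (n + 1)} (hp : (i : ℕ) ≤ p)
    {ν : Fin n →₀ ℕ} (h : IsBallot 0 (insertZero p (ν + Finsupp.single i 1))) : IsBallot 0 ν := by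
  intro j hj
  set μ := ν + Finsupp.single i 1 with hμ
  have hval : ∀ l : Fin n, (p.succAbove l : ℕ) ≤ l + 1 ∧ ((l : ℕ) < p → (p.succAbove l : ℕ) = l) := by
    intro l
    rcases lt_or_ge l.castSucc p with hl | hl
    · rw [Fin.succAbove_of_castSucc_lt _ _ hl]
      simp
    · rw [Fin.succAbove_of_le_castSucc _ _ hl]
      rw [Fin.le_def, Fin.val_castSucc] at hl
      simp only [Fin.val_succ]
      omega
  have h1 := partialSum_add_single ν i (j + 1)
  rw [← hμ] at h1
  by_cases hij : (i : ℕ) ≤ j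
  · have h2 := h (j + 1) (by omega)
    have h3 : partialSum μ (j + 1) ≤ partialSum (insertZero p μ) (j + 1 + 1) := by
      rw [partialSum_insertZero]
      refine Finset.sum_le_sum fun l _ => ?_
      have := hval l
      split_ifs <;> omega
    rw [if_pos (by omega)] at h1
    omega
  · have h2 := h j (by omega)
    have h3 : partialSum μ (j + 1) ≤ partialSum (insertZero p μ) (j + 1) := by
      rw [partialSum_insertZero]
      refine Finset.sum_le_sum fun l _ => ?_
      have := hval l
      split_ifs <;> omega
    rw [if_neg (by omega)] at h1
    omega

theorem coeff_zero_of_mem_J {n : ℕ} {f : MvPolynomial (Fin n) ℚ} (hf : f ∈ J n) :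
    coeff 0 f = 0 := by
  have h : J n ≤ RingHom.ker (constantCoeff : MvPolynomial (Fin n) ℚ →+* ℚ) := by
    rw [J, Ideal.span_le]
    exact fun P hP => hP.2
  simpa [constantCoeff_eq] using h hf

/-- An element of `J n` all of whose monomials are ballot monomials is zero. -/
theorem eq_zero_of_mem_J_of_isBallot {n : ℕ} {f : MvPolynomial (Fin n) ℚ} (hf : f ∈ J n)
    (hB : ∀ ν, coeff ν f ≠ 0 → IsBallot 0 ν) : f = 0 := by
  have hconst := coeff_zero_of_mem_J hf
  induction n with
  | zero =>
    ext ν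
    rw [Subsingleton.elim ν 0, hconst, coeff_zero]
  | succ n ih =>
    -- The divided difference `h` of `f` is a ballot-supported element of `J n`, hence zero by
    -- induction.
    have hswap : ∀ (i : Fin n) (ν : Fin n →₀ ℕ),
        coeff (insertZero i.castSucc ν) f = coeff (insertZero i.succ ν) f := by
      intro i ν
      obtain ⟨h, hh, hdiff⟩ := exists_dividedDifference i hf
      have hcoeff : ∀ μ, coeff μ h = coeff (insertZero i.succ (μ + Finsupp.single i 1)) f -
          coeff (insertZero i.castSucc (μ + Finsupp.single i 1)) f := by
        intro μ
        rw [← coeff_eraseVar, ← coeff_eraseVar, ← coeff_sub, hdiff, add_comm, coeff_X_mul]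
      have hzero : h = 0 := by
        have hballot : ∀ μ, coeff μ h ≠ 0 → IsBallot 0 μ := by
          intro μ hμ
          rw [hcoeff] at hμ
          by_cases h1 : coeff (insertZero i.succ (μ + Finsupp.single i 1)) f = 0
          · exact (hB _ fun h2 => hμ (by rw [h1, h2, sub_zero])).of_insertZero (by simp)
          · exact (hB _ h1).of_insertZero (by simp)
        exact ih hh hballot (coeff_zero_of_mem_J hh)
      rw [hzero, mul_zero, sub_eq_zero] at hdiff
      rw [← coeff_eraseVar, ← coeff_eraseVar, hdiff]
    -- `hswap` moves a nonzero entry left across a zero without changing the coefficient, until it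
    -- reaches the first position, where the ballot condition forbids it.
    have key : ∀ (i : Fin (n + 1)) (η : Fin (n + 1) →₀ ℕ), η i ≠ 0 → coeff η f = 0 := by
      intro i
      induction i using Fin.induction with
      | zero =>
        intro η hη
        by_contra hne
        have := hB η hne 0 (by omega)
        rw [← Finsupp.cons_tail η, partialSum_cons] at this
        omega
      | succ i ihi =>
        intro η hη
        by_cases h0 : η i.castSucc = 0
        · obtain ⟨ν, rfl⟩ := exists_eq_insertZero h0
          rw [hswap]
          refine ihi _ ?_
          rw [← Fin.succAbove_castSucc_self i, insertZero_succAbove] at hη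
          rwa [← Fin.succAbove_succ_self i, insertZero_succAbove]
        · exact ihi η h0
    ext ν
    by_cases hν : ν = 0
    · rw [hν, hconst, coeff_zero]
    · obtain ⟨i, hi⟩ := DFunLike.ne_iff.1 hν
      rw [key i ν hi, coeff_zero]

/-! ### Homogeneity of the ideal and the basis of the quotient -/

theorem sum_filter_ne_zero (l : List ℕ) : (l.filter (· ≠ 0)).sum = l.sum := by
  induction l with
  | nil => rfl
  | cons a l ih => by_cases h : a = 0 <;> simp_all

theorem degree_eq_sum_compositionOf {n : ℕ} (ν : Fin n →₀ ℕ) :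
    ν.degree = (compositionOf ν).sum := by
  rw [compositionOf, sum_filter_ne_zero, List.sum_ofFn, Finsupp.degree_eq_sum]

theorem IsQuasiSymmetric.homogeneousComponent {n : ℕ} {P : MvPolynomial (Fin n) ℚ}
    (hP : IsQuasiSymmetric P) (k : ℕ) : IsQuasiSymmetric (homogeneousComponent k P) := by
  intro ν μ h
  rw [coeff_homogeneousComponent, coeff_homogeneousComponent, degree_eq_sum_compositionOf,
    degree_eq_sum_compositionOf, h, hP ν μ h]

-- The degree of a monomial depends only on its composition, so the homogeneous components of a
-- quasi-symmetric polynomial are quasi-symmetric and generate the same ideal.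
attribute [local instance] MvPolynomial.gradedAlgebra in
theorem homogeneousComponent_mem_J {n : ℕ} {P : MvPolynomial (Fin n) ℚ} (hP : P ∈ J n) (k : ℕ) :
    homogeneousComponent k P ∈ J n := by
  suffices h : (J n).IsHomogeneous (homogeneousSubmodule (Fin n) ℚ) from
    homogeneousComponent_mem_of_mem h hP k
  have hJ : J n = Ideal.span {P | (IsQuasiSymmetric P ∧ constantCoeff P = 0) ∧
      ∃ k, P.IsHomogeneous k} := by
    apply le_antisymm
    · rw [J, Ideal.span_le]
      rintro P ⟨hP, h0⟩
      rw [SetLike.mem_coe, ← sum_homogeneousComponent P]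
      refine sum_mem fun k _ => Ideal.subset_span
        ⟨⟨hP.homogeneousComponent k, ?_⟩, k, homogeneousComponent_isHomogeneous k P⟩
      rw [constantCoeff_eq] at h0 ⊢
      rw [coeff_homogeneousComponent, h0, ite_self]
    · exact Ideal.span_mono fun P hP => hP.1
  rw [hJ]
  refine Ideal.homogeneous_span _ _ ?_
  rintro P ⟨_, k, hk⟩
  exact ⟨k, hk⟩

/-- The ballot exponents with degree in `K`. -/
def ballotSet (n : ℕ) (K : Set ℕ) : Set (Fin n →₀ ℕ) :=
  {η | IsBallot 0 η ∧ η.degree ∈ K}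

theorem partialSum_self {n : ℕ} (ν : Fin n →₀ ℕ) : partialSum ν n = ν.degree := by
  simp [partialSum, Finsupp.degree_eq_sum]

theorem IsBallot.degree_le {n : ℕ} {η : Fin n →₀ ℕ} (h : IsBallot 0 η) : η.degree ≤ n - 1 := by
  rw [← partialSum_self]
  rcases n with _ | n
  · simp [partialSum]
  · simpa using h n (by omega)

instance finite_ballotSet (n : ℕ) (K : Set ℕ) : Finite (ballotSet n K) :=
  ((Finsupp.finite_of_degree_le (n - 1)).subset fun _ h => h.1.degree_le).to_subtype

/-- The family of the classes of the ballot monomials with degree in `K`. -/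
noncomputable def ballotClass (n : ℕ) (K : Set ℕ) (η : ballotSet n K) : R n :=
  Ideal.Quotient.mkₐ ℚ (J n) (monomial η.1 1)

theorem linearIndependent_ballotClass (n : ℕ) (K : Set ℕ) :
    LinearIndependent ℚ (ballotClass n K) := by
  have h1 : LinearIndependent ℚ fun η : ballotSet n K =>
      (monomial η.1 1 : MvPolynomial (Fin n) ℚ) := by
    have := (basisMonomials (Fin n) ℚ).linearIndependent.comp
      (fun η : ballotSet n K => η.1) Subtype.val_injective
    simpa [Function.comp_def] using this
  refine h1.map (f := (Ideal.Quotient.mkₐ ℚ (J n)).toLinearMap) ?_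
  rw [Submodule.disjoint_def]
  intro P hP hker
  refine eq_zero_of_mem_J_of_isBallot (Ideal.Quotient.eq_zero_iff_mem.1 hker) ?_
  have h2 : P ∈ restrictSupport ℚ (ballotSet n K) := by
    rw [restrictSupport_eq_span, Set.image_eq_range]
    exact hP
  intro ν hν
  exact ((mem_restrictSupport_iff ℚ).1 h2 (mem_support_iff.2 hν)).1

/-- A functional separating the class of `P` from the span, composed with projection to degree `k`,
would kill the ideal and all ballot monomials, hence be zero. -/
theorem mem_span_ballotClass {n k : ℕ} {P : MvPolynomial (Fin n) ℚ} (hP : P.IsHomogeneous k) :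
    Ideal.Quotient.mkₐ ℚ (J n) P ∈ Submodule.span ℚ (Set.range (ballotClass n {k})) := by
  by_contra hmem
  obtain ⟨χ, hχP, hχ⟩ := Submodule.exists_le_ker_of_notMem hmem
  let φ : MvPolynomial (Fin n) ℚ →ₗ[ℚ] ℚ :=
    χ ∘ₗ (Ideal.Quotient.mkₐ ℚ (J n)).toLinearMap ∘ₗ homogeneousComponent k
  have hφ : ∀ Q, φ Q = χ (Ideal.Quotient.mkₐ ℚ (J n) (homogeneousComponent k Q)) := fun Q => rfl
  have h0 : φ = 0 := by
    refine eq_zero_of_excessIdeal_of_isBallot n 0 φ (fun Q hQ => ?_) (fun η hη => ?_)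
    · have : Ideal.Quotient.mkₐ ℚ (J n) (homogeneousComponent k Q) = 0 :=
        Ideal.Quotient.eq_zero_iff_mem.2
          (homogeneousComponent_mem_J (excessIdeal_le_J n 0 hQ) k)
      rw [hφ, this, map_zero]
    · rw [hφ, homogeneousComponent_of_mem (isHomogeneous_monomial (1 : ℚ) rfl)]
      split_ifs with hk
      · exact hχ (Submodule.subset_span ⟨⟨η, hη, hk.symm⟩, rfl⟩)
      · rw [map_zero, map_zero]
  apply hχP
  have := hφ P
  rwa [h0, homogeneousComponent_of_mem hP, if_pos rfl, LinearMap.zero_apply, eq_comm] at this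

theorem RDeg_eq_span (n k : ℕ) : RDeg n k = Submodule.span ℚ (Set.range (ballotClass n {k})) := by
  apply le_antisymm
  · rintro _ ⟨P, hP, rfl⟩
    exact mem_span_ballotClass hP
  · rw [Submodule.span_le]
    rintro _ ⟨η, rfl⟩
    exact ⟨monomial η.1 1, isHomogeneous_monomial 1 η.2.2, rfl⟩

theorem span_ballotClass_univ (n : ℕ) :
    Submodule.span ℚ (Set.range (ballotClass n Set.univ)) = ⊤ := by
  rw [eq_top_iff]
  rintro x -
  obtain ⟨P, rfl⟩ := Ideal.Quotient.mkₐ_surjective ℚ (J n) x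
  rw [← sum_homogeneousComponent P, map_sum]
  refine sum_mem fun k _ => Submodule.span_mono ?_
    (mem_span_ballotClass (homogeneousComponent_isHomogeneous k P))
  rintro _ ⟨η, rfl⟩
  exact ⟨⟨η.1, η.2.1, Set.mem_univ _⟩, rfl⟩

/-- The basis of `R n` consisting of the classes of the ballot monomials. -/
noncomputable def ballotBasis (n : ℕ) : Module.Basis (ballotSet n Set.univ) ℚ (R n) :=
  Module.Basis.mk (linearIndependent_ballotClass n Set.univ) (span_ballotClass_univ n).ge

theorem finrank_R (n : ℕ) : Module.finrank ℚ (R n) = Nat.card (ballotSet n Set.univ) :=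
  Module.finrank_eq_nat_card_basis (ballotBasis n)

theorem finite_R (n : ℕ) : Module.Finite ℚ (R n) :=
  Module.Finite.of_basis (ballotBasis n)

theorem finrank_RDeg (n k : ℕ) : Module.finrank ℚ (RDeg n k) = Nat.card (ballotSet n {k}) := by
  have := Fintype.ofFinite (ballotSet n {k})
  rw [RDeg_eq_span, finrank_span_eq_card (linearIndependent_ballotClass n {k}),
    Nat.card_eq_fintype_card]

/-! ### The pairing and the duality between `SH n` and `R n` -/

theorem exists_coeff_pderiv_pow {n : ℕ} (i : Fin n) (k : ℕ) (μ : Fin n →₀ ℕ) :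
    ∃ c : ℚ, c ≠ 0 ∧ ∀ Q : MvPolynomial (Fin n) ℚ,
      coeff μ ((((pderiv i).toLinearMap : Module.End ℚ (MvPolynomial (Fin n) ℚ)) ^ k) Q) =
        c * coeff (μ + Finsupp.single i k) Q := by
  induction k generalizing μ with
  | zero => exact ⟨1, one_ne_zero, fun Q => by simp⟩
  | succ k ih =>
    obtain ⟨c, hc, h⟩ := ih (μ + Finsupp.single i 1)
    refine ⟨(μ i + 1) * c, mul_ne_zero (by positivity) hc, fun Q => ?_⟩
    rw [pow_succ', Module.End.mul_apply]
    change coeff μ (pderiv i _) = _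
    rw [coeff_pderiv, h, add_assoc, ← Finsupp.single_add, add_comm 1 k]
    ring

theorem exists_coeff_prod_pderiv {n : ℕ} (ν : Fin n → ℕ) (l : List (Fin n)) (μ : Fin n →₀ ℕ) :
    ∃ c : ℚ, c ≠ 0 ∧ ∀ Q : MvPolynomial (Fin n) ℚ,
      coeff μ ((l.map fun i => ((pderiv i).toLinearMap :
        Module.End ℚ (MvPolynomial (Fin n) ℚ)) ^ ν i).prod Q) =
        c * coeff (μ + (l.map fun i => Finsupp.single i (ν i)).sum) Q := by
  induction l generalizing μ with
  | nil => exact ⟨1, one_ne_zero, fun Q => by simp⟩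
  | cons i l ih =>
    obtain ⟨c, hc, h⟩ := exists_coeff_pderiv_pow i (ν i) μ
    obtain ⟨d, hd, h'⟩ := ih (μ + Finsupp.single i (ν i))
    refine ⟨c * d, mul_ne_zero hc hd, fun Q => ?_⟩
    rw [List.map_cons, List.prod_cons, Module.End.mul_apply, h, h', List.map_cons, List.sum_cons,
      add_assoc, mul_assoc]

/-- Only the nonvanishing of the constant is needed for duality, so its factorial value is never
computed. -/
theorem exists_eval_monomialDiff {n : ℕ} (ν : Fin n →₀ ℕ) :
    ∃ c : ℚ, c ≠ 0 ∧ ∀ Q : MvPolynomial (Fin n) ℚ,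
      eval (0 : Fin n → ℚ) (monomialDiff ν Q) = c * coeff ν Q := by
  obtain ⟨c, hc, h⟩ := exists_coeff_prod_pderiv ν (List.finRange n) 0
  refine ⟨c, hc, fun Q => ?_⟩
  have hsum : ((List.finRange n).map fun i => Finsupp.single i (ν i)).sum = ν := by
    rw [← List.ofFn_eq_map, List.sum_ofFn, Finsupp.univ_sum_single]
  rw [hsum, zero_add] at h
  rw [← h, eval_zero, constantCoeff_eq, monomialDiff, List.ofFn_eq_map]

/-- The value `⟨X^ν, X^ν⟩` of the pairing. -/
noncomputable def monomialNorm {n : ℕ} (ν : Fin n →₀ ℕ) : ℚ :=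
  (exists_eval_monomialDiff ν).choose

theorem monomialNorm_ne_zero {n : ℕ} (ν : Fin n →₀ ℕ) : monomialNorm ν ≠ 0 :=
  (exists_eval_monomialDiff ν).choose_spec.1

/-- The linear functional `⟨·, Q⟩`. -/
noncomputable def pairingLeft {n : ℕ} (Q : MvPolynomial (Fin n) ℚ) :
    MvPolynomial (Fin n) ℚ →ₗ[ℚ] ℚ :=
  (basisMonomials (Fin n) ℚ).constr ℚ fun ν => monomialNorm ν * coeff ν Q

theorem pairingLeft_monomial {n : ℕ} (Q : MvPolynomial (Fin n) ℚ) (ν : Fin n →₀ ℕ) :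
    pairingLeft Q (monomial ν 1) = monomialNorm ν * coeff ν Q := by
  have := (basisMonomials (Fin n) ℚ).constr_basis ℚ (fun ν => monomialNorm ν * coeff ν Q) ν
  rwa [coe_basisMonomials] at this

theorem pairingLeft_apply {n : ℕ} (P Q : MvPolynomial (Fin n) ℚ) :
    pairingLeft Q P = pairing P Q := by
  conv_lhs => rw [as_sum P]
  rw [map_sum, pairing, diffOp, LinearMap.sum_apply, map_sum]
  refine Finset.sum_congr rfl fun ν _ => ?_
  rw [LinearMap.smul_apply, smul_eval, (exists_eval_monomialDiff ν).choose_spec.2,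
    ← mul_one (coeff ν P), ← smul_eq_mul (coeff ν P) 1, ← smul_monomial, map_smul,
    pairingLeft_monomial, smul_eq_mul, smul_eq_mul, mul_one, monomialNorm]

theorem mem_SH_iff {n : ℕ} {Q : MvPolynomial (Fin n) ℚ} :
    Q ∈ SH n ↔ ∀ P ∈ J n, pairingLeft Q P = 0 := by
  simp only [pairingLeft_apply]
  rfl

/-- The degree bound makes the representing series a polynomial. -/
theorem exists_pairingLeft_eq {n : ℕ} (φ : MvPolynomial (Fin n) ℚ →ₗ[ℚ] ℚ) (N : ℕ)
    (h : ∀ ν : Fin n →₀ ℕ, N < ν.degree → φ (monomial ν 1) = 0) :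
    ∃ Q, pairingLeft Q = φ := by
  let Q : MvPolynomial (Fin n) ℚ := ∑ μ ∈ (Finsupp.finite_of_degree_le N).toFinset,
    monomial μ (φ (monomial μ 1) / monomialNorm μ)
  have hcoeff : ∀ ν : Fin n →₀ ℕ, coeff ν Q = φ (monomial ν 1) / monomialNorm ν := by
    intro ν
    rw [coeff_sum]
    simp only [coeff_monomial, Finset.sum_ite_eq', Set.Finite.mem_toFinset, Set.mem_ofPred_eq]
    split_ifs with hν
    · rfl
    · rw [h ν (by omega), zero_div]
  refine ⟨Q, sub_eq_zero.1 (linearMap_eq_zero_of_monomial fun ν => ?_)⟩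
  rw [LinearMap.sub_apply, pairingLeft_monomial, hcoeff,
    mul_div_cancel₀ _ (monomialNorm_ne_zero ν), sub_self]

/-- The super-covariant polynomials with degrees in `K` are determined by their coefficients at
the ballot exponents, which are arbitrary. -/
theorem nonempty_linearEquiv_ballotSet {n : ℕ} {K : Set ℕ}
    {W : Submodule ℚ (MvPolynomial (Fin n) ℚ)}
    (hW : ∀ Q, Q ∈ W ↔ Q ∈ SH n ∧ ∀ ν, coeff ν Q ≠ 0 → ν.degree ∈ K) :
    Nonempty (W ≃ₗ[ℚ] (ballotSet n K → ℚ)) := by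
  let e : W →ₗ[ℚ] (ballotSet n K → ℚ) :=
    LinearMap.pi fun η => lcoeff ℚ η.1 ∘ₗ W.subtype
  have he : ∀ (Q : W) (η : ballotSet n K), e Q η = coeff η.1 Q.1 := fun Q η => rfl
  refine ⟨LinearEquiv.ofBijective e ⟨?_, ?_⟩⟩
  · rw [injective_iff_map_eq_zero]
    rintro ⟨Q, hQ⟩ hzero
    obtain ⟨hSH, hK⟩ := (hW Q).1 hQ
    have h0 : pairingLeft Q = 0 := by
      refine eq_zero_of_excessIdeal_of_isBallot n 0 _
        (fun P hP => mem_SH_iff.1 hSH P (excessIdeal_le_J n 0 hP)) (fun η hη => ?_)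
      rw [pairingLeft_monomial]
      by_cases hηK : η.degree ∈ K
      · have := congrFun hzero ⟨η, hη, hηK⟩
        rw [he] at this
        rw [this, Pi.zero_apply, mul_zero]
      · rw [not_not.1 (mt (hK η) hηK), mul_zero]
    ext ν
    have := pairingLeft_monomial Q ν
    rw [h0, LinearMap.zero_apply, eq_comm, mul_eq_zero] at this
    simpa using this.resolve_left (monomialNorm_ne_zero ν)
  · intro d
    classical
    -- The norm factor cancels the one in the pairing, so that the representing polynomial has
    -- coefficients exactly `d`.
    let χ : R n →ₗ[ℚ] ℚ := (ballotBasis n).constr ℚ fun η =>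
      if h : η.1.degree ∈ K then monomialNorm η.1 * d ⟨η.1, η.2.1, h⟩ else 0
    have hχ : ∀ (η : Fin n →₀ ℕ) (hη : IsBallot 0 η),
        χ (Ideal.Quotient.mkₐ ℚ (J n) (monomial η 1)) =
          if h : η.degree ∈ K then monomialNorm η * d ⟨η, hη, h⟩ else 0 := by
      intro η hη
      have hb : Ideal.Quotient.mkₐ ℚ (J n) (monomial η 1) =
          ballotBasis n ⟨η, hη, Set.mem_univ _⟩ := by
        rw [ballotBasis, Module.Basis.mk_apply]
        rfl
      rw [hb]
      exact (ballotBasis n).constr_basis ℚ _ _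
    let φ : MvPolynomial (Fin n) ℚ →ₗ[ℚ] ℚ := χ ∘ₗ (Ideal.Quotient.mkₐ ℚ (J n)).toLinearMap
    have hφ : ∀ P, φ P = χ (Ideal.Quotient.mkₐ ℚ (J n) P) := fun P => rfl
    -- A monomial reduces to ballot monomials of its own degree. This yields both the degree bound
    -- that makes `Q` exist and the support of `Q` in `K`.
    have hdeg : ∀ ν : Fin n →₀ ℕ, (∀ η : Fin n →₀ ℕ, IsBallot 0 η → η.degree = ν.degree →
        η.degree ∉ K) → φ (monomial ν 1) = 0 := by
      intro ν hν
      have hle : Submodule.span ℚ (Set.range (ballotClass n {ν.degree})) ≤ LinearMap.ker χ := by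
        rw [Submodule.span_le]
        rintro _ ⟨η, rfl⟩
        change χ (Ideal.Quotient.mkₐ ℚ (J n) (monomial η.1 1)) = 0
        rw [hχ _ η.2.1, dif_neg (hν _ η.2.1 η.2.2)]
      exact hle (mem_span_ballotClass (isHomogeneous_monomial 1 rfl))
    obtain ⟨Q, hQ⟩ := exists_pairingLeft_eq φ (n - 1) fun ν hν => hdeg ν fun η hη h => by
      have := hη.degree_le
      omega
    have hcoeff : ∀ ν, monomialNorm ν * coeff ν Q = φ (monomial ν 1) := fun ν => by
      rw [← hQ, pairingLeft_monomial]
    have hQW : Q ∈ W := by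
      refine (hW Q).2 ⟨mem_SH_iff.2 fun P hP => ?_, fun ν hν => ?_⟩
      · have : Ideal.Quotient.mkₐ ℚ (J n) P = 0 := Ideal.Quotient.eq_zero_iff_mem.2 hP
        rw [hQ, hφ, this, map_zero]
      · by_contra hK
        refine mul_ne_zero (monomialNorm_ne_zero ν) hν ?_
        rw [hcoeff]
        exact hdeg ν fun η _ h => h ▸ hK
    refine ⟨⟨Q, hQW⟩, funext fun η => ?_⟩
    rw [he]
    apply mul_left_cancel₀ (monomialNorm_ne_zero η.1)
    rw [hcoeff, hφ, hχ _ η.2.1, dif_pos η.2.2]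

theorem nonempty_linearEquiv_SH (n : ℕ) :
    Nonempty (SH n ≃ₗ[ℚ] (ballotSet n Set.univ → ℚ)) :=
  nonempty_linearEquiv_ballotSet fun Q => by simp

theorem nonempty_linearEquiv_SHDeg (n k : ℕ) :
    Nonempty (SHDeg n k ≃ₗ[ℚ] (ballotSet n {k} → ℚ)) :=
  nonempty_linearEquiv_ballotSet fun Q => by
    rw [SHDeg, Submodule.mem_inf, mem_homogeneousSubmodule]
    refine and_congr_right fun _ => ⟨fun h ν hν => ?_, fun h ν hν => ?_⟩
    · by_contra hne
      exact hν (h.coeff_eq_zero hne)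
    · exact (DFunLike.congr_fun Finsupp.degree_eq_weight_one ν).symm.trans (h ν hν)

theorem finite_SH (n : ℕ) : Module.Finite ℚ (SH n) :=
  Module.Finite.equiv (nonempty_linearEquiv_SH n).some.symm

theorem finrank_SH (n : ℕ) : Module.finrank ℚ (SH n) = Nat.card (ballotSet n Set.univ) := by
  have := Fintype.ofFinite (ballotSet n Set.univ)
  rw [(nonempty_linearEquiv_SH n).some.finrank_eq, Module.finrank_fintype_fun_eq_card,
    Nat.card_eq_fintype_card]

theorem finrank_SHDeg (n k : ℕ) :
    Module.finrank ℚ (SHDeg n k) = Nat.card (ballotSet n {k}) := by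
  have := Fintype.ofFinite (ballotSet n {k})
  rw [(nonempty_linearEquiv_SHDeg n k).some.finrank_eq, Module.finrank_fintype_fun_eq_card,
    Nat.card_eq_fintype_card]

end

section

/-! ### Counting ballot exponents by degree -/

theorem card_ballotSet_zero (n : ℕ) : Nat.card (ballotSet n {0}) = 1 := by
  have h : ballotSet n {0} = {0} := by
    ext η
    constructor
    · exact fun h => (Finsupp.degree_eq_zero_iff η).1 h.2
    · rintro rfl
      exact ⟨fun j _ => by simp [partialSum], by simp⟩
  rw [h, Nat.card_unique]

theorem card_ballotSet_of_le {n k : ℕ} (hn : 1 ≤ n) (hk : n ≤ k) :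
    Nat.card (ballotSet n {k}) = 0 := by
  have : IsEmpty (ballotSet n {k}) := ⟨fun η => by
    have h1 := η.2.1.degree_le
    have h2 : η.1.degree = k := η.2.2
    omega⟩
  exact Nat.card_of_isEmpty

theorem partialSum_insertZero_last {n : ℕ} (ν : Fin n →₀ ℕ) (j : ℕ) :
    partialSum (insertZero (Fin.last n) ν) j = partialSum ν j := by
  rw [partialSum_insertZero]
  simp [partialSum]

theorem degree_insertZero {n : ℕ} (p : Fin (n + 1)) (ν : Fin n →₀ ℕ) :
    (insertZero p ν).degree = ν.degree := by
  rw [insertZero, Finsupp.degree_mapDomain]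

theorem isBallot_insertZero_last {n : ℕ} {ν : Fin n →₀ ℕ} :
    IsBallot 0 (insertZero (Fin.last n) ν) ↔ IsBallot 0 ν := by
  refine ⟨fun h j hj => ?_, fun h j hj => ?_⟩
  · rw [← partialSum_insertZero_last]
    exact h j (by omega)
  · rcases Nat.lt_succ_iff_lt_or_eq.1 hj with hj | rfl
    · rw [partialSum_insertZero_last]
      exact h j hj
    · have h1 : partialSum (insertZero (Fin.last j) ν) (j + 1) = ν.degree := by
        rw [partialSum_self, degree_insertZero]
      have := h.degree_le
      omega

theorem isBallot_add_single_last {n : ℕ} {ν : Fin (n + 1) →₀ ℕ} (hν : ν.degree + 1 ≤ n) :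
    IsBallot 0 (ν + Finsupp.single (Fin.last n) 1) ↔ IsBallot 0 ν := by
  refine forall₂_congr fun j hj => ?_
  rw [partialSum_add_single]
  rcases Nat.lt_succ_iff_lt_or_eq.1 hj with hj | rfl
  · rw [Fin.val_last, if_neg (by omega), Nat.add_zero]
  · rw [partialSum_self]
    split_ifs <;> omega

theorem insertZero_injective {n : ℕ} (p : Fin (n + 1)) : Function.Injective (insertZero p) :=
  Finsupp.mapDomain_injective Fin.succAbove_right_injective

/-- If the last entry is zero it is deleted, otherwise it is lowered by one. As the degree is at
most `n`, the last ballot inequality holds automatically and neither operation can break it. -/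
theorem card_ballotSet_succ {n k : ℕ} (hk : k + 1 ≤ n) :
    Nat.card (ballotSet (n + 1) {k + 1}) =
      Nat.card (ballotSet n {k + 1}) + Nat.card (ballotSet (n + 1) {k}) := by
  have h : ballotSet (n + 1) {k + 1} = insertZero (Fin.last n) '' ballotSet n {k + 1} ∪
      (fun ν => ν + Finsupp.single (Fin.last n) 1) '' ballotSet (n + 1) {k} := by
    ext η
    constructor
    · rintro ⟨hB, hd⟩
      rw [Set.mem_singleton_iff] at hd
      by_cases h0 : η (Fin.last n) = 0
      · obtain ⟨ν, rfl⟩ := exists_eq_insertZero h0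
        rw [degree_insertZero] at hd
        exact Or.inl ⟨ν, ⟨isBallot_insertZero_last.1 hB, hd⟩, rfl⟩
      · obtain ⟨ν, rfl⟩ : ∃ ν, η = ν + Finsupp.single (Fin.last n) 1 :=
          ⟨η - Finsupp.single (Fin.last n) 1,
            (tsub_add_cancel_of_le (Finsupp.single_le_iff.2 (by omega))).symm⟩
        rw [map_add, Finsupp.degree_single] at hd
        exact Or.inr ⟨ν, ⟨(isBallot_add_single_last (by omega)).1 hB, by
          rw [Set.mem_singleton_iff]; omega⟩, rfl⟩
    · rintro (⟨ν, ⟨hB, hd⟩, rfl⟩ | ⟨ν, ⟨hB, hd⟩, rfl⟩)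
      · exact ⟨isBallot_insertZero_last.2 hB, by rwa [degree_insertZero]⟩
      · rw [Set.mem_singleton_iff] at hd
        exact ⟨(isBallot_add_single_last (by omega)).2 hB, by
          rw [map_add, Finsupp.degree_single, hd, Set.mem_singleton_iff]⟩
  rw [Nat.card_coe_set_eq, Nat.card_coe_set_eq, Nat.card_coe_set_eq, h, Set.ncard_union_eq,
    Set.ncard_image_of_injective _ (insertZero_injective _),
    Set.ncard_image_of_injective _ (add_left_injective _)]
  · rw [Set.disjoint_left]
    rintro _ ⟨ν, _, rfl⟩ ⟨μ, _, h⟩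
    have := DFunLike.congr_fun h (Fin.last n)
    simp at this

theorem card_ballotSet_eq_sum (n : ℕ) {k : ℕ} (hk : k ≤ n) :
    Nat.card (ballotSet (n + 1) {k}) = ∑ i ∈ Finset.range (k + 1), Nat.card (ballotSet n {i}) := by
  induction k with
  | zero => rw [zero_add, Finset.sum_range_one, card_ballotSet_zero, card_ballotSet_zero]
  | succ k ih => 
    rw [card_ballotSet_succ hk, ih (by omega), Finset.sum_range_succ _ (k + 1), add_comm]

theorem card_ballotSet_univ (n : ℕ) :
    Nat.card (ballotSet n Set.univ) = Nat.card (ballotSet (n + 1) {n}) := by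
  have hfin : (ballotSet n Set.univ).Finite := Set.toFinite _
  rw [card_ballotSet_eq_sum n le_rfl, Nat.card_coe_set_eq, Set.ncard_eq_toFinset_card _ hfin,
    Finset.card_eq_sum_card_fiberwise (f := Finsupp.degree) (t := Finset.range (n + 1))]
  · refine Finset.sum_congr rfl fun k _ => ?_
    rw [Nat.card_coe_set_eq, ← Set.ncard_coe_finset]
    congr 1
    ext η
    simp [ballotSet]
  · intro η hη
    have := ((hfin.mem_toFinset).1 hη).1.degree_le
    simp only [Finset.coe_range, Set.mem_Iio]
    omega

/-! ### Catalan's triangle and powers of the Catalan series -/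

/-- An array with the initial values and the recurrence of Catalan's triangle. -/
structure IsCatalanTriangle (c : ℕ → ℕ → ℕ) : Prop where
  zero_right : ∀ n, c n 0 = 1
  self_succ : ∀ n, c (n + 1) (n + 1) = 0
  succ_succ : ∀ n k, k + 1 ≤ n → c (n + 1) (k + 1) = c n (k + 1) + c (n + 1) k

/-- Pascal's rule gives the recurrence, and the two middle binomials agree on the diagonal. The
subtracted term stands on the left to stay within `ℕ`. -/
theorem IsCatalanTriangle.add_choose {c : ℕ → ℕ → ℕ} (hc : IsCatalanTriangle c) {n k : ℕ}
    (hk : k + 1 ≤ n) : c n (k + 1) + (n + k).choose k = (n + k).choose (k + 1) := by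
  induction k generalizing n with
  | zero =>
    induction n, hk using Nat.le_induction with
    | base => simp [hc.self_succ]
    | succ n hn ih =>
      rw [hc.succ_succ n 0 hn, hc.zero_right]
      simp at ih ⊢
      omega
  | succ k ihk =>
    induction n, hk using Nat.le_induction with
    | base =>
      rw [hc.self_succ, zero_add, show k + 1 + 1 + (k + 1) = 2 * (k + 1) + 1 by ring,
        Nat.choose_symm_half]
    | succ n hn ih =>
      have h1 := ihk (n := n + 1) (by omega)
      rw [show n + 1 + k = n + (k + 1) by ring] at h1
      rw [hc.succ_succ n _ hn, show n + 1 + (k + 1) = n + (k + 1) + 1 by ring,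
        Nat.choose_succ_succ', Nat.choose_succ_succ']
      omega

theorem IsCatalanTriangle.eq {c d : ℕ → ℕ → ℕ} (hc : IsCatalanTriangle c)
    (hd : IsCatalanTriangle d) {n k : ℕ} (hk : k ≤ n) : c n k = d n k := by
  rcases k with _ | k
  · rw [hc.zero_right, hd.zero_right]
  · have h1 := hc.add_choose hk
    have h2 := hd.add_choose hk
    omega

theorem IsCatalanTriangle.eq_div_mul_choose {c : ℕ → ℕ → ℕ} (hc : IsCatalanTriangle c) {n k : ℕ}
    (hk : k < n) :
    (c n k : ℚ) = ((n : ℚ) - (k : ℚ)) / ((n : ℚ) + (k : ℚ)) * ((n + k).choose k : ℚ) := by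
  have hn : (0 : ℚ) < n := by exact_mod_cast (by omega : 0 < n)
  rcases k with _ | k
  · simp [hc.zero_right, hn.ne']
  · have h1 : (c n (k + 1) : ℚ) + (n + k).choose k = (n + k).choose (k + 1) := by
      exact_mod_cast hc.add_choose hk.le
    have h2 : ((n : ℚ) + k + 1) * (n + k).choose k = (n + (k + 1)).choose (k + 1) * (k + 1) := by
      exact_mod_cast Nat.add_one_mul_choose_eq (n + k) k
    have h3 : ((n + (k + 1)).choose (k + 1) : ℚ) = (n + k).choose k + (n + k).choose (k + 1) := by
      exact_mod_cast Nat.choose_succ_succ (n + k) k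
    rw [div_mul_eq_mul_div, eq_div_iff (by positivity)]
    push_cast
    linear_combination ((n : ℚ) + k + 1) * h1 - ((n : ℚ) + k + 1) * h3 - 2 * h2

theorem isCatalanTriangle_card_ballotSet :
    IsCatalanTriangle fun n k => Nat.card (ballotSet n {k}) where
  zero_right := card_ballotSet_zero
  self_succ n := card_ballotSet_of_le (by omega) le_rfl
  succ_succ _ _ hk := card_ballotSet_succ hk

open PowerSeries in
/-- The coefficients of the powers of `X * C(X)`, where `C` is the Catalan series. -/
noncomputable def catalanPower (n j : ℕ) : ℕ :=
  coeff n ((X * catalanSeries) ^ j)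

-- Multiply `C = 1 + X * C ^ 2` by `X * (X * C) ^ j` and compare coefficients.
open PowerSeries in
theorem catalanPower_succ_succ (n j : ℕ) :
    catalanPower (n + 1) (j + 1) = catalanPower n j + catalanPower (n + 1) (j + 2) := by
  have h : (X * catalanSeries) ^ (j + 1) =
      X * (X * catalanSeries) ^ j + (X * catalanSeries) ^ (j + 2) := by
    calc (X * catalanSeries) ^ (j + 1) = (X * catalanSeries) ^ j * X * catalanSeries := by ring
      _ = (X * catalanSeries) ^ j * X * (catalanSeries ^ 2 * X + 1) := by
        rw [catalanSeries_sq_mul_X_add_one]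
      _ = _ := by ring
  rw [catalanPower, h, map_add, coeff_succ_X_mul]
  rfl

open PowerSeries in
theorem catalanPower_succ_eq_sum (n j : ℕ) :
    catalanPower (n + 1) (j + 1) =
      ∑ p ∈ Finset.HasAntidiagonal.antidiagonal n, catalan p.1 * catalanPower p.2 j := by
  rw [catalanPower, pow_succ', mul_assoc, coeff_succ_X_mul, coeff_mul]
  simp only [catalanSeries_coeff, catalanPower]

open PowerSeries in
theorem catalanPower_zero_right (n : ℕ) : catalanPower n 0 = if n = 0 then 1 else 0 := by
  rw [catalanPower, pow_zero, coeff_one]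

open PowerSeries in
theorem catalanPower_zero_succ (j : ℕ) : catalanPower 0 (j + 1) = 0 := by
  simp [catalanPower]

open PowerSeries in
theorem catalanPower_self (n : ℕ) : catalanPower n n = 1 := by
  rw [catalanPower, mul_pow, ← zero_add n, coeff_X_pow_mul' ]
  simp

open PowerSeries in
theorem catalanPower_one_right (n : ℕ) : catalanPower (n + 1) 1 = catalan n := by
  rw [catalanPower, pow_one, coeff_succ_X_mul, catalanSeries_coeff]

theorem isCatalanTriangle_catalanPower :
    IsCatalanTriangle fun n k => catalanPower n (n - k) where
  zero_right n := catalanPower_self n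
  self_succ n := by simp [catalanPower_zero_right]
  succ_succ n k hk := by
    obtain ⟨j, rfl⟩ := Nat.exists_eq_add_of_le hk
    rw [show k + 1 + j + 1 - (k + 1) = j + 1 by omega, show k + 1 + j - (k + 1) = j by omega,
      show k + 1 + j + 1 - k = j + 2 by omega, catalanPower_succ_succ]

theorem card_ballotSet_univ_eq_catalan (n : ℕ) :
    Nat.card (ballotSet n Set.univ) = catalan n := by
  have := isCatalanTriangle_card_ballotSet.eq isCatalanTriangle_catalanPower
    (n := n + 1) (k := n) (by omega)
  rw [card_ballotSet_univ, this, Nat.add_sub_cancel_left, catalanPower_one_right]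

/-! ### Dyck paths by factors and by final falls -/

open DyckWord

/-- The number of Dyck words of semilength `n` with the property `P`. -/
noncomputable def dyckCount (P : DyckWord → Prop) (n : ℕ) : ℕ :=
  {p : DyckWord | p.semilength = n ∧ P p}.ncard

theorem semilength_eq_zero {p : DyckWord} : p.semilength = 0 ↔ p = 0 := by
  rw [← toList_eq_nil, ← List.length_eq_zero_iff, ← two_mul_semilength_eq_length]
  omega

theorem finite_dyckWord (n : ℕ) (P : DyckWord → Prop) :
    {p : DyckWord | p.semilength = n ∧ P p}.Finite :=
  Set.Finite.subset (s := {p : DyckWord | p.semilength = n})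
    (Set.finite_coe_iff.1 (Finite.of_fintype {p : DyckWord // p.semilength = n})) fun _ h => h.1

theorem dyckCount_true (n : ℕ) : dyckCount (fun _ => True) n = catalan n := by
  rw [dyckCount, ← card_dyckWord_semilength_eq_catalan, ← Nat.card_eq_fintype_card,
    ← Nat.card_coe_set_eq]
  simp only [and_true]
  rfl

theorem dyckCount_zero_of {P : DyckWord → Prop} (h : P 0) : dyckCount P 0 = 1 := by
  rw [dyckCount, Set.ncard_eq_one]
  refine ⟨0, Set.ext fun p => ⟨fun hp => ?_, ?_⟩⟩
  · exact semilength_eq_zero.1 hp.1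
  · rintro rfl
    exact ⟨rfl, h⟩

theorem dyckCount_eq_zero {P : DyckWord → Prop} {n : ℕ}
    (h : ∀ p : DyckWord, p.semilength = n → ¬ P p) : dyckCount P n = 0 := by
  rw [dyckCount, Set.ncard_eq_zero (finite_dyckWord n P), Set.eq_empty_iff_forall_notMem]
  exact fun p hp => h p hp.1 hp.2

theorem nest_add_injective :
    Function.Injective fun p : DyckWord × DyckWord => p.1.nest + p.2 := by
  rintro ⟨a, b⟩ ⟨c, d⟩ h
  have h1 := congrArg insidePart h
  have h2 := congrArg outsidePart h
  simp only [insidePart_add (nest_ne_zero), insidePart_nest, outsidePart_add nest_ne_zero,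
    outsidePart_nest, zero_add] at h1 h2
  rw [h1, h2]

/-- Counting by the decomposition of a Dyck word at its first return. -/
theorem dyckCount_succ (P : DyckWord → Prop) (n : ℕ) :
    dyckCount P (n + 1) = ∑ ij ∈ Finset.HasAntidiagonal.antidiagonal n,
      {ab : DyckWord × DyckWord | ab.1.semilength = ij.1 ∧ ab.2.semilength = ij.2 ∧
        P (ab.1.nest + ab.2)}.ncard := by
  let S : Set (DyckWord × DyckWord) :=
    {ab | ab.1.semilength + ab.2.semilength = n ∧ P (ab.1.nest + ab.2)}
  have himage : {p : DyckWord | p.semilength = n + 1 ∧ P p} =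
      (fun p : DyckWord × DyckWord => p.1.nest + p.2) '' S := by
    ext p
    constructor
    · rintro ⟨hp, hP⟩
      have h0 : p ≠ 0 := by
        rintro rfl
        simp at hp
      refine ⟨(p.insidePart, p.outsidePart), ⟨?_, ?_⟩, nest_insidePart_add_outsidePart h0⟩
      · have := semilength_insidePart_add_semilength_outsidePart_add_one h0
        change p.insidePart.semilength + p.outsidePart.semilength = n
        omega
      · change P (p.insidePart.nest + p.outsidePart)
        rwa [nest_insidePart_add_outsidePart h0]
    · rintro ⟨ab, ⟨h1, h2⟩, rfl⟩
      refine ⟨?_, h2⟩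
      simp only [semilength_add, semilength_nest]
      omega
  have hS : S.Finite :=
    Set.Finite.of_finite_image (himage ▸ finite_dyckWord (n + 1) P) nest_add_injective.injOn
  rw [dyckCount, himage, Set.ncard_image_of_injective _ nest_add_injective,
    Set.ncard_eq_toFinset_card _ hS,
    Finset.card_eq_sum_card_fiberwise (t := Finset.HasAntidiagonal.antidiagonal n)
      (f := fun ab : DyckWord × DyckWord => (ab.1.semilength, ab.2.semilength))]
  · refine Finset.sum_congr rfl fun ij hij => ?_
    rw [Finset.HasAntidiagonal.mem_antidiagonal] at hij
    rw [← Set.ncard_coe_finset]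
    congr 1
    ext ab
    simp only [Finset.coe_filter, Set.Finite.mem_toFinset, Set.mem_ofPred_eq, Prod.ext_iff, S]
    constructor
    · rintro ⟨⟨h1, h2⟩, h3, h4⟩
      exact ⟨h3, h4, h2⟩
    · rintro ⟨h3, h4, h2⟩
      exact ⟨⟨by omega, h2⟩, h3, h4⟩
  · intro ab hab
    simpa using (hS.mem_toFinset.1 hab).1

theorem ncard_semilength_prod (i j : ℕ) (Q : DyckWord → Prop) :
    {ab : DyckWord × DyckWord | ab.1.semilength = i ∧ ab.2.semilength = j ∧ Q ab.2}.ncard =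
      catalan i * dyckCount Q j := by
  rw [← dyckCount_true, dyckCount, dyckCount, ← Set.ncard_prod]
  congr 1
  ext ab
  simp [Set.mem_prod]

theorem axisPoints_nest_add (a b : DyckWord) :
    axisPoints (a.nest + b) = axisPoints b + 1 := by
  have hlist : (a.nest + b).toList = DyckStep.U :: (a.toList ++ DyckStep.D :: b.toList) := by
    change [DyckStep.U] ++ a.toList ++ [DyckStep.D] ++ b.toList = _
    simp
  have hlen : (a.nest + b).toList.length + 1 = (a.toList.length + 1 + 1) + (b.toList.length + 1) := by
    rw [hlist]
    simp
    omega
  -- Index `0` gives the extra axis point, the rest of the first factor before its return stays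
  -- above the axis, and the later prefixes are those of `b`.
  rw [axisPoints, Finset.card_filter, hlen, Finset.sum_range_add, Finset.sum_range_succ',
    axisPoints, Finset.card_filter, Finset.sum_eq_zero, zero_add, add_comm]
  · congr 1
    refine Finset.sum_congr rfl fun i _ => ?_
    have htake : (a.nest + b).toList.take (a.toList.length + 1 + 1 + i) =
        DyckStep.U :: (a.toList ++ DyckStep.D :: b.toList.take i) := by
      rw [hlist, show a.toList.length + 1 + 1 + i = (a.toList.length + (i + 1)) + 1 by ring,
        List.take_succ_cons, List.take_length_add_append, List.take_succ_cons]
    have ha := a.count_U_eq_count_D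
    rw [htake]
    congr 1
    simp
    omega
  · intro i hi
    rw [Finset.mem_range] at hi
    have ha := a.count_D_le_count_U i
    rw [if_neg]
    rw [hlist, List.take_succ_cons, List.take_append_of_le_length (by omega)]
    simp
    omega

theorem U_mem_toList {p : DyckWord} (hp : p ≠ 0) : DyckStep.U ∈ p.toList := by
  have h := toList_ne_nil.2 hp
  rw [← p.head_eq_U h]
  exact List.head_mem h

/-- Read backwards, the run of falls stops at a rise inside `b`. -/
theorem finalFalls_add (a : DyckWord) {b : DyckWord} (hb : b ≠ 0) :
    finalFalls (a + b) = finalFalls b := by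
  have hlist : (a + b).toList.reverse = b.toList.reverse ++ a.toList.reverse := by
    rw [← List.reverse_append]
    rfl
  rw [finalFalls, finalFalls, hlist, List.takeWhile_append, if_neg]
  intro h
  have h1 := List.takeWhile_prefix (l := b.toList.reverse) (fun s => decide (s = DyckStep.D))
  have h2 := List.mem_takeWhile_imp (p := fun s => decide (s = DyckStep.D))
    (l := b.toList.reverse) (x := DyckStep.U)
    (by rw [h1.eq_of_length h]; simpa using U_mem_toList hb)
  simp at h2

theorem finalFalls_nest (a : DyckWord) : finalFalls a.nest = finalFalls a + 1 := by
  have hlist : a.nest.toList.reverse = DyckStep.D :: (a.toList.reverse ++ [DyckStep.U]) := by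
    change ([DyckStep.U] ++ a.toList ++ [DyckStep.D]).reverse = _
    simp
  rw [finalFalls, finalFalls, hlist, List.takeWhile_cons_of_pos (by simp), List.length_cons,
    List.takeWhile_append]
  split_ifs with h
  · simpa using h.symm
  · rfl

theorem axisPoints_zero : axisPoints 0 = 1 := rfl

theorem finalFalls_zero : finalFalls 0 = 0 := rfl

theorem exists_eq_nest_add {p : DyckWord} {n : ℕ} (hp : p.semilength = n + 1) :
    ∃ a b : DyckWord, p = a.nest + b := by
  refine ⟨p.insidePart, p.outsidePart, (nest_insidePart_add_outsidePart ?_).symm⟩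
  rintro rfl
  simp at hp

theorem axisPoints_pos (p : DyckWord) : 0 < axisPoints p := by
  rw [axisPoints, Finset.card_pos]
  exact ⟨0, by simp⟩

theorem dyckByFactors_eq_catalanPower (n j : ℕ) : dyckByFactors n j = catalanPower n j := by
  change dyckCount (fun p => axisPoints p = j + 1) n = _
  induction j generalizing n with
  | zero =>
    rw [catalanPower_zero_right]
    rcases n with _ | n
    · exact dyckCount_zero_of axisPoints_zero
    · refine dyckCount_eq_zero fun p hp => ?_
      obtain ⟨a, b, rfl⟩ := exists_eq_nest_add hp
      have := axisPoints_pos b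
      rw [axisPoints_nest_add]
      omega
  | succ j ih =>
    rcases n with _ | n
    · rw [catalanPower_zero_succ]
      refine dyckCount_eq_zero fun p hp => ?_
      rw [semilength_eq_zero.1 hp, axisPoints_zero]
      omega
    · rw [dyckCount_succ, catalanPower_succ_eq_sum]
      refine Finset.sum_congr rfl fun ij _ => ?_
      simp only [axisPoints_nest_add, add_left_inj]
      rw [← ih, ← ncard_semilength_prod]

theorem catalanPower_succ_eq_add_sum (n j : ℕ) :
    catalanPower (n + 1) (j + 1) = catalanPower n j +
      ∑ p ∈ Finset.HasAntidiagonal.antidiagonal n, catalan p.1 * catalanPower p.2 (j + 1) := by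
  rw [catalanPower_succ_succ, catalanPower_succ_eq_sum n (j + 1)]

/-- The final falls lie in the outer part `b` unless it is empty; then they are those of the inner
part plus the closing step, which accounts for the term at `ij.2 = 0`. -/
theorem ncard_finalFalls_nest_add (j : ℕ) (ij : ℕ × ℕ) :
    {ab : DyckWord × DyckWord | ab.1.semilength = ij.1 ∧ ab.2.semilength = ij.2 ∧
      finalFalls (ab.1.nest + ab.2) = j + 1}.ncard =
      (if ij.2 = 0 then dyckCount (fun p => finalFalls p = j) ij.1 else 0) +
        catalan ij.1 * dyckCount (fun p => finalFalls p = j + 1) ij.2 := by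
  rcases ij with ⟨i, _ | k⟩
  · have h0 : dyckCount (fun p => finalFalls p = j + 1) 0 = 0 := dyckCount_eq_zero fun p hp => by
      rw [semilength_eq_zero.1 hp, finalFalls_zero]
      omega
    have himage : {ab : DyckWord × DyckWord | ab.1.semilength = i ∧ ab.2.semilength = 0 ∧
        finalFalls (ab.1.nest + ab.2) = j + 1} =
        (fun a => (a, 0)) '' {a : DyckWord | a.semilength = i ∧ finalFalls a = j} := by
      ext ⟨a, b⟩
      simp only [Set.mem_ofPred_eq, semilength_eq_zero, Set.mem_image, Prod.mk.injEq]
      constructor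
      · rintro ⟨h1, rfl, h2⟩
        rw [add_zero, finalFalls_nest, add_left_inj] at h2
        exact ⟨a, ⟨h1, h2⟩, rfl, rfl⟩
      · rintro ⟨c, ⟨h1, h2⟩, rfl, rfl⟩
        exact ⟨h1, rfl, by rw [add_zero, finalFalls_nest, h2]⟩
    rw [h0, mul_zero, add_zero, if_pos rfl, dyckCount, himage,
      Set.ncard_image_of_injective _ (Prod.mk_left_injective _)]
  · rw [if_neg (by simp), zero_add, ← ncard_semilength_prod]
    congr 1
    ext ab
    refine and_congr_right fun _ => and_congr_right fun h => ?_
    rw [finalFalls_add]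
    rintro h0
    simp [h0] at h

theorem dyckByFinalFalls_eq_catalanPower (n j : ℕ) :
    dyckByFinalFalls n j = catalanPower n j := by
  change dyckCount (fun p => finalFalls p = j) n = _
  induction n using Nat.strong_induction_on generalizing j with
  | _ n ih =>
  rcases n with _ | n
  · rcases j with _ | j
    · rw [catalanPower_self, dyckCount_zero_of finalFalls_zero]
    · rw [catalanPower_zero_succ]
      refine dyckCount_eq_zero fun p hp => ?_
      rw [semilength_eq_zero.1 hp, finalFalls_zero]
      omega
  · rcases j with _ | j
    · rw [catalanPower_zero_right, if_neg (by omega)]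
      refine dyckCount_eq_zero fun p hp => ?_
      obtain ⟨a, b, rfl⟩ := exists_eq_nest_add hp
      by_cases hb : b = 0
      · rw [hb, add_zero, finalFalls_nest]
        omega
      · rw [finalFalls_add _ hb]
        rcases Nat.exists_eq_add_one_of_ne_zero (mt semilength_eq_zero.1 hb) with ⟨m, hm⟩
        have hle : b.semilength ≤ n := by
          simp only [semilength_add, semilength_nest] at hp
          omega
        have h0 := ih b.semilength (by omega) 0
        rw [hm, catalanPower_zero_right, if_neg (by omega), ← hm, dyckCount,
          Set.ncard_eq_zero (finite_dyckWord _ _)] at h0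
        exact fun hF => Set.eq_empty_iff_forall_notMem.1 h0 b ⟨rfl, hF⟩
    · rw [dyckCount_succ, catalanPower_succ_eq_add_sum]
      simp only [ncard_finalFalls_nest_add]
      rw [Finset.sum_add_distrib]
      congr 1
      -- The pair `(n, 0)` is the case of a path with a single factor.
      · rw [Finset.sum_eq_single (n, 0)]
        · rw [if_pos rfl, ih n (by omega)]
        · rintro ⟨a, b⟩ hab hne
          rw [Finset.HasAntidiagonal.mem_antidiagonal] at hab
          rw [if_neg]
          rintro rfl
          exact hne (by simpa using hab)
        · simp
      · refine Finset.sum_congr rfl fun ab hab => ?_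
        rw [Finset.HasAntidiagonal.mem_antidiagonal] at hab
        rw [ih _ (by omega)]

end

end SuperCovariant

open SuperCovariant

theorem theorem1 (n : ℕ) (hn : 1 ≤ n) :
    (Module.Finite ℚ (SuperCovariant.SH n) ∧
      Module.Finite ℚ (SuperCovariant.R n) ∧
      Module.finrank ℚ (SuperCovariant.SH n) = Module.finrank ℚ (SuperCovariant.R n) ∧
      Module.finrank ℚ (SuperCovariant.R n) = catalan n ∧
      (catalan n : ℚ) = 1 / ((n : ℚ) + 1) * ((2 * n).choose n : ℚ)) ∧
    (∀ k : ℕ, k < n →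
      Module.finrank ℚ (SuperCovariant.SHDeg n k) = Module.finrank ℚ (SuperCovariant.RDeg n k) ∧
      Module.finrank ℚ (SuperCovariant.RDeg n k) = SuperCovariant.dyckByFinalFalls n (n - k) ∧
      SuperCovariant.dyckByFinalFalls n (n - k) = SuperCovariant.dyckByFactors n (n - k) ∧
      (SuperCovariant.dyckByFactors n (n - k) : ℚ) =
        ((n : ℚ) - (k : ℚ)) / ((n : ℚ) + (k : ℚ)) * ((n + k).choose k : ℚ)) ∧
    (∀ k : ℕ, n ≤ k →
      Module.finrank ℚ (SuperCovariant.SHDeg n k) = 0 ∧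
      Module.finrank ℚ (SuperCovariant.RDeg n k) = 0) ∧
    SuperCovariant.hilbertSeries n =
      ∑ k ∈ Finset.range n,
        PowerSeries.monomial k
          (((n : ℚ) - (k : ℚ)) / ((n : ℚ) + (k : ℚ)) * ((n + k).choose k : ℚ)) := by
  have hsh := fun k => (finrank_SHDeg n k).trans (finrank_RDeg n k).symm
  have hcount : ∀ k < n, Module.finrank ℚ (RDeg n k) = catalanPower n (n - k) := fun k hk =>
    (finrank_RDeg n k).trans
      (isCatalanTriangle_card_ballotSet.eq isCatalanTriangle_catalanPower hk.le)
  have hformula : ∀ k < n, (catalanPower n (n - k) : ℚ) =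
      ((n : ℚ) - (k : ℚ)) / ((n : ℚ) + (k : ℚ)) * ((n + k).choose k : ℚ) := fun k hk =>
    isCatalanTriangle_catalanPower.eq_div_mul_choose hk
  have hzero : ∀ k, n ≤ k → Module.finrank ℚ (RDeg n k) = 0 := fun k hk =>
    (finrank_RDeg n k).trans (card_ballotSet_of_le hn hk)
  refine ⟨⟨finite_SH n, finite_R n, (finrank_SH n).trans (finrank_R n).symm,
    (finrank_R n).trans (card_ballotSet_univ_eq_catalan n), ?_⟩, fun k hk => ⟨hsh k, ?_, ?_, ?_⟩,
    fun k hk => ⟨(hsh k).trans (hzero k hk), hzero k hk⟩, ?_⟩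
  · have h : ((n : ℚ) + 1) * catalan n = (2 * n).choose n := by
      exact_mod_cast succ_mul_catalan_eq_centralBinom n
    rw [← h]
    field_simp
  · rw [hcount k hk, dyckByFinalFalls_eq_catalanPower]
  · rw [dyckByFinalFalls_eq_catalanPower, dyckByFactors_eq_catalanPower]
  · rw [dyckByFactors_eq_catalanPower, hformula k hk]
  · ext k
    rw [hilbertSeries, PowerSeries.coeff_mk, hsh, map_sum]
    simp only [PowerSeries.coeff_monomial, Finset.sum_ite_eq, Finset.mem_range]
    split_ifs with hk
    · rw [hcount k hk, hformula k hk]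
    · rw [hzero k (by omega), Nat.cast_zero]
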